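/- Let $q\in L^1_{\rm loc}(\mathbb R)$ be complex-valued. Put $\sigma_3=\begin{pmatrix}1&0\\0&-1\end{pmatrix}$, $\sigma_4=\begin{pmatrix}0&1\\-1&0\end{pmatrix}$, $$\widetilde{\mathscr D}=i\sigma_3\frac{d}{dx}+i\begin{pmatrix}0&-q\\-\overline q&0\end{pmatrix},\qquad \widetilde{\mathscr H}=-\sigma_4\frac{d}{dx}+i\begin{pmatrix}-\mathrm{Re}\,q&-\mathrm{Im}\,q\\-\mathrm{Im}\,q&\mathrm{Re}\,q\end{pmatrix}=U\widetilde{\mathscr D}U^{-1},\qquad U=\frac12\begin{pmatrix}-1+i&-1+i\\1+i&-1-i\end{pmatrix}.$$ For $\theta\in\mathbb R$ let $\alpha(\theta)=(\cos\theta,\sin\theta)$ and $\beta(\theta)=\alpha(\theta)U=\frac{-1+i}{2}(e^{-i\theta},e^{i\theta})$. Let $\widetilde D$ be the maximal operator of $\widetilde{\mathscr D}$ in $L^2(\mathbb R)^2$, with domain all $\Psi\in L^2(\mathbb R)^2\cap AC_{\rm loc}(\mathbb R)^2$ such that $\widetilde{\mathscr D}\Psi\in L^2(\mathbb R)^2$,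 and let $\widetilde D_\pm(\beta(\theta))$ be the operator of $\widetilde{\mathscr D}$ in $L^2([0,\pm\infty))^2$, with domain all $\Psi\in L^2([0,\pm\infty))^2\cap AC_{\rm loc}([0,\pm\infty))^2$ such that $\beta(\theta)\Psi(0)=0$ and $\widetilde{\mathscr D}\Psi\in L^2([0,\pm\infty))^2$. Let $\rho(\cdot)$ denote the resolvent set. Let $\Theta^{\widetilde{\mathscr H}}(z,\cdot,\alpha(\theta))$, $\Phi^{\widetilde{\mathscr H}}(z,\cdot,\alpha(\theta))\in AC_{\rm loc}(\mathbb R)^2$ be the solutions of $\widetilde{\mathscr H}\Psi=z\Psi$ with values $(\cos\theta,\sin\theta)^\top$ and $(-\sin\theta,\cos\theta)^\top$ at $x=0$. Let $\Theta^{\widetilde{\mathscr D}}=U^{-1}\Theta^{\widetilde{\mathscr H}}$ and $\Phi^{\widetilde{\mathscr D}}=U^{-1}\Phi^{\widetilde{\mathscr H}}$ be the corresponding solutions of $\widetilde{\mathscr D}\Psi=z\Psi$, with values $-\frac{1+i}{2}(e^{i\theta},e^{-i\theta})^\top$ and $\frac{1-i}{2}(e^{i\theta},-e^{-i\theta})^\top$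 at $x=0$. For $\mathscr E\in\{\widetilde{\mathscr D},\widetilde{\mathscr H}\}$, with $\gamma(\theta)=\beta(\theta)$ if $\mathscr E=\widetilde{\mathscr D}$ and $\gamma(\theta)=\alpha(\theta)$ if $\mathscr E=\widetilde{\mathscr H}$, a number $m$ is a Weyl–Titchmarsh coefficient $m^{\mathscr E}_\pm(z,\gamma(\theta))$ if $\Theta^{\mathscr E}(z,\cdot,\gamma(\theta))+m\,\Phi^{\mathscr E}(z,\cdot,\gamma(\theta))\in L^2([0,\pm\infty))^2$. Fix a sign $\pm$, let $\theta\in\mathbb R$ and let $z\in\rho(\widetilde D)\cap\rho(\widetilde D_\pm(\beta(\theta)))$. Then $m^{\widetilde{\mathscr D}}_\pm(z,\beta(\theta))$ and $m^{\widetilde{\mathscr H}}_\pm(z,\alpha(\theta))$ exist, are unique and coincide; write $\widetilde m_\pm(z,\gamma(\theta))$ for their common value. Moreover: 1. A coefficient $\widetilde m_\pm(\overline z,\gamma(\theta))$ exists, for either system, if and only if $\widetilde m_\pm(z,\gamma(\theta))\ne0$; this holds in particular if $\overline z\in\rho(\widetilde D_\pm(\beta(\theta)))$. In this case it is unique, and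 $$\overline{\widetilde m_\pm(z,\gamma(\theta))}=-\big[\widetilde m_\pm(\overline z,\gamma(\theta))\big]^{-1}.$$ 2. One has $\overline z\in\rho(\widetilde D)\cap\rho(\widetilde D_\pm(\beta(\theta-\pi/2)))$, and $$\overline{m^{\widetilde{\mathscr D}}_\pm(z,\beta(\theta))}=m^{\widetilde{\mathscr D}}_\pm(\overline z,\beta(\theta-\pi/2)),\qquad \overline{m^{\widetilde{\mathscr H}}_\pm(z,\alpha(\theta))}=m^{\widetilde{\mathscr H}}_\pm(\overline z,\alpha(\theta-\pi/2)).$$ -/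

import Mathlib

open MeasureTheory Set Topology
open scoped ComplexConjugate Matrix

noncomputable section

/-- The space `ℂ²` with its Euclidean norm. -/
abbrev Spinor : Type := EuclideanSpace ℂ (Fin 2)

/-- Complex `2 × 2` matrices. -/
abbrev Mat2 : Type := Matrix (Fin 2) (Fin 2) ℂ

/-- A `2 × 2` matrix acting on a vector of `ℂ²`. -/
def act (A : Mat2) : Spinor →ₗ[ℂ] Spinor := Matrix.toEuclideanLin A

theorem act_apply (A : Mat2) (v : Spinor) (j : Fin 2) :
    act A v j = A j 0 * v 0 + A j 1 * v 1 := by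
  simp [act, Matrix.mulVec, dotProduct, Fin.sum_univ_two]

/-! ### First order `2 × 2` systems -/

/-- `Ψ ∈ AC_loc(I)²` for an interval `I`. -/
def LocallyAbsContOn (Ψ : ℝ → Spinor) (I : Set ℝ) : Prop :=
  ∀ a ∈ I, ∀ b ∈ I, AbsolutelyContinuousOnInterval Ψ a b

/-- The differential expression `A d/dx + Q`, applied to `Ψ`, equals `g` a.e. on `I`. -/
def ExprEq (A : Mat2) (Q : ℝ → Mat2) (I : Set ℝ) (Ψ g : ℝ → Spinor) : Prop :=
  ∀ᵐ x ∂(volume.restrict I),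
    DifferentiableAt ℝ Ψ x ∧ act A (deriv Ψ x) + act (Q x) (Ψ x) = g x

/-- `Ψ` is a `z`-wave function of `A d/dx + Q`: a locally absolutely continuous solution on `ℝ`
of `A Ψ' + Q Ψ = z Ψ`. -/
def IsWaveFunction (A : Mat2) (Q : ℝ → Mat2) (z : ℂ) (Ψ : ℝ → Spinor) : Prop :=
  LocallyAbsContOn Ψ univ ∧ ExprEq A Q univ Ψ (fun x => z • Ψ x)

/-- The Hilbert space `L²(I)²`. -/
abbrev L2 (I : Set ℝ) : Type := Lp Spinor 2 (volume.restrict I)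

/-- The graph of the realization of `A d/dx + Q` in `L²(I)²` on all `Ψ ∈ L²(I)² ∩ AC_loc(I)²`
with `Ψ(0) ∈ bc` and `A Ψ' + Q Ψ ∈ L²(I)²`. -/
def exprGraph (A : Mat2) (Q : ℝ → Mat2) (I : Set ℝ) (bc : Submodule ℂ Spinor) :
    Submodule ℂ (L2 I × L2 I) where
  carrier := {p | ∃ Ψ : ℝ → Spinor, LocallyAbsContOn Ψ I ∧ Ψ 0 ∈ bc ∧
    p.1 =ᵐ[volume.restrict I] Ψ ∧ ExprEq A Q I Ψ p.2}
  zero_mem' := by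
    refine ⟨fun _ => 0, ?_, bc.zero_mem, Lp.coeFn_zero _ _ _, ?_⟩
    · intro a _ b _
      exact ((LipschitzWith.const (0 : Spinor)).lipschitzOnWith
        (s := uIcc a b)).absolutelyContinuousOnInterval
    · filter_upwards [Lp.coeFn_zero Spinor 2 (volume.restrict I)] with x hx
      refine ⟨by fun_prop, ?_⟩
      simp only [Prod.snd_zero, hx]
      simp
  add_mem' := by
    rintro ⟨f, g⟩ ⟨f', g'⟩ ⟨Ψ, h1, h2, h3, h4⟩ ⟨Ψ', h1', h2', h3', h4'⟩
    refine ⟨Ψ + Ψ', fun a ha b hb => (h1 a ha b hb).add (h1' a ha b hb),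
      bc.add_mem h2 h2', (Lp.coeFn_add f f').trans (h3.add h3'), ?_⟩
    filter_upwards [Lp.coeFn_add g g', h4, h4'] with x hx h h'
    refine ⟨h.1.add h'.1, ?_⟩
    simp only [Prod.mk_add_mk, hx, Pi.add_apply, ← h.2, ← h'.2, deriv_add h.1 h'.1, map_add]
    abel
  smul_mem' := by
    rintro c ⟨f, g⟩ ⟨Ψ, h1, h2, h3, h4⟩
    refine ⟨c • Ψ, fun a ha b hb => (h1 a ha b hb).const_smul c,
      bc.smul_mem c h2, (Lp.coeFn_smul c f).trans (h3.const_smul c), ?_⟩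
    filter_upwards [Lp.coeFn_smul c g, h4] with x hx h
    refine ⟨h.1.const_smul c, ?_⟩
    simp only [Prod.smul_mk, hx, Pi.smul_apply, ← h.2, deriv_const_smul c h.1, map_smul, smul_add]

/-- The realization of `A d/dx + Q` in `L²(I)²` with boundary condition `Ψ(0) ∈ bc`,
as an unbounded operator. -/
def exprOp (A : Mat2) (Q : ℝ → Mat2) (I : Set ℝ) (bc : Submodule ℂ Spinor) :
    L2 I →ₗ.[ℂ] L2 I :=
  (exprGraph A Q I bc).toLinearPMap

/-- The graph is single-valued on the intervals used below, so the operator has this graph. -/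
theorem exprOp_graph (A : Mat2) (Q : ℝ → Mat2) (I : Set ℝ) (bc : Submodule ℂ Spinor)
    (hI : ∀ᵐ x ∂(volume.restrict I), I ∈ 𝓝 x) :
    (exprOp A Q I bc).graph = exprGraph A Q I bc := by
  refine Submodule.toLinearPMap_graph_eq _ ?_
  rintro ⟨f, g⟩ ⟨Ψ, -, -, h3, h4⟩ (rfl : f = 0)
  have hΨ : ∀ᵐ x ∂(volume.restrict I), Ψ x = 0 := by
    filter_upwards [h3, Lp.coeFn_zero Spinor 2 (volume.restrict I)] with x hx hx'
    rw [← hx]; exact hx'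
  refine Lp.ext ?_
  filter_upwards [hI, h4, hΨ, Lp.coeFn_zero Spinor 2 (volume.restrict I)] with x hxI hx hx0 hz
  have hd : deriv Ψ x = 0 := by
    by_contra hne
    have hev := hx.1.hasDerivAt.eventually_ne (c := (0 : Spinor)) hne
    rw [eventually_nhdsWithin_iff] at hev
    obtain ⟨V, hV, hVo, hxV⟩ := mem_nhds_iff.1 (Filter.inter_mem hxI hev)
    have h0 : volume (V \ {x}) = 0 := by
      refine measure_mono_null ?_ (Measure.measure_inter_eq_zero_of_restrict (ae_iff.1 hΨ))
      rintro y ⟨hy, hyx⟩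
      exact ⟨(hV hy).2 hyx, (hV hy).1⟩
    have h1 : volume V = 0 := by
      refine measure_mono_null (t := (V \ {x}) ∪ {x}) ?_ (measure_union_null h0 (by simp))
      intro y hy
      by_cases h : y = x
      · exact Or.inr h
      · exact Or.inl ⟨hy, h⟩
    exact (hVo.measure_pos volume ⟨x, hxV⟩).ne' h1
  have := hx.2
  rw [hd, hx0] at this
  rw [hz]
  simpa using this.symm

/-- The resolvent set of a closed operator `T`: all `z` such that `T - z` is a bijection of the
domain of `T` onto the whole space, with bounded inverse `R`. -/
def opResolventSet {E : Type*} [NormedAddCommGroup E] [NormedSpace ℂ E] (T : E →ₗ.[ℂ] E) :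
    Set ℂ :=
  {z | ∃ R : E →L[ℂ] E,
    (∀ h : E, ∃ f : T.domain, (f : E) = R h ∧ T f - z • (f : E) = h) ∧
    ∀ f : T.domain, R (T f - z • (f : E)) = f}

/-! ### The focusing Dirac and Hamiltonian expressions -/

/-- The matrix `i σ₃`. -/
def diracMatrix : Mat2 := !![Complex.I, 0; 0, -Complex.I]

/-- The potential `Q̃ = i (0, -q; -q̄, 0)` of the non-self-adjoint Dirac expression. -/
def diracPotential (q : ℝ → ℂ) (x : ℝ) : Mat2 :=
  !![0, -Complex.I * q x; -Complex.I * conj (q x), 0]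

/-- The matrix `-σ₄`. -/
def hamMatrix : Mat2 := !![0, -1; 1, 0]

/-- The potential `B̃ = i (-Re q, -Im q; -Im q, Re q)` of the Hamiltonian expression. -/
def hamPotential (q : ℝ → ℂ) (x : ℝ) : Mat2 :=
  !![-Complex.I * (q x).re, -Complex.I * (q x).im; -Complex.I * (q x).im, Complex.I * (q x).re]

/-- The unitary matrix `U` relating the two expressions. -/
def unitaryU : Mat2 :=
  !![(-1 + Complex.I) / 2, (-1 + Complex.I) / 2; (1 + Complex.I) / 2, (-1 - Complex.I) / 2]

theorem unitaryU_mul_conjTranspose : unitaryU * unitaryUᴴ = 1 := by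
  ext i j
  fin_cases i <;> fin_cases j <;>
    simp [unitaryU, Matrix.mul_apply, Fin.sum_univ_two, map_ofNat] <;>
    ring_nf <;> simp [Complex.I_sq] <;> norm_num

theorem unitaryU_mul_diracMatrix : unitaryU * diracMatrix = hamMatrix * unitaryU := by
  ext i j
  fin_cases i <;> fin_cases j <;>
    simp [unitaryU, diracMatrix, hamMatrix, Matrix.mul_apply, Fin.sum_univ_two,
      Complex.ext_iff] <;> norm_num

theorem unitaryU_mul_diracPotential (q : ℝ → ℂ) (x : ℝ) :
    unitaryU * diracPotential q x = hamPotential q x * unitaryU := by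
  ext i j
  fin_cases i <;> fin_cases j <;>
    simp [unitaryU, diracPotential, hamPotential, Matrix.mul_apply, Fin.sum_univ_two,
      Complex.ext_iff] <;> constructor <;> ring

/-- The two half-lines `[0, ∞)` and `(-∞, 0]`. -/
inductive Side where
  | plus : Side
  | minus : Side

/-- The half-line belonging to a sign. -/
def Side.halfLine : Side → Set ℝ
  | .plus => Ici 0
  | .minus => Iic 0

/-- The boundary vector `β(θ) = ((-1 + i)/2) (e^{-iθ}, e^{iθ})`. -/
def betaVec (θ : ℝ) : Fin 2 → ℂ :=
  ![(-1 + Complex.I) / 2 * Complex.exp (-(Complex.I * θ)),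
    (-1 + Complex.I) / 2 * Complex.exp (Complex.I * θ)]

/-- The vectors `v ∈ ℂ²` with `b v = 0`, for a row vector `b`. -/
def boundarySpace (b : Fin 2 → ℂ) : Submodule ℂ Spinor where
  carrier := {v | b 0 * v 0 + b 1 * v 1 = 0}
  zero_mem' := by simp
  add_mem' := by
    intro v w hv hw
    simp only [mem_ofPred_eq, PiLp.add_apply] at *
    linear_combination hv + hw
  smul_mem' := by
    intro c v hv
    simp only [mem_ofPred_eq, PiLp.smul_apply, smul_eq_mul] at *
    linear_combination c * hv

/-- The maximal Dirac operator `D̃` in `L²(ℝ)²`. -/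
def diracOp (q : ℝ → ℂ) : L2 univ →ₗ.[ℂ] L2 univ :=
  exprOp diracMatrix (diracPotential q) univ ⊤

/-- The half-line Dirac operator `D̃±(β(θ))` in `L²([0, ±∞))²` with boundary condition
`β(θ) Ψ(0) = 0`. -/
def halfLineDiracOp (q : ℝ → ℂ) (s : Side) (θ : ℝ) : L2 s.halfLine →ₗ.[ℂ] L2 s.halfLine :=
  exprOp diracMatrix (diracPotential q) s.halfLine (boundarySpace (betaVec θ))

theorem diracOp_graph (q : ℝ → ℂ) :
    (diracOp q).graph = exprGraph diracMatrix (diracPotential q) univ ⊤ :=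
  exprOp_graph _ _ _ _ (by simp)

theorem halfLineDiracOp_graph (q : ℝ → ℂ) (s : Side) (θ : ℝ) :
    (halfLineDiracOp q s θ).graph = exprGraph diracMatrix (diracPotential q) s.halfLine
      (boundarySpace (betaVec θ)) := by
  refine exprOp_graph _ _ _ _ ?_
  cases s
  · change ∀ᵐ x ∂(volume.restrict (Ici (0 : ℝ))), Ici (0 : ℝ) ∈ 𝓝 x
    rw [← Measure.restrict_congr_set (Ioi_ae_eq_Ici (μ := volume) (a := (0 : ℝ)))]
    filter_upwards [ae_restrict_mem measurableSet_Ioi] with x hx using Ici_mem_nhds hx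
  · change ∀ᵐ x ∂(volume.restrict (Iic (0 : ℝ))), Iic (0 : ℝ) ∈ 𝓝 x
    rw [← Measure.restrict_congr_set (Iio_ae_eq_Iic (μ := volume) (a := (0 : ℝ)))]
    filter_upwards [ae_restrict_mem measurableSet_Iio] with x hx using Iic_mem_nhds hx

/-! ### Weyl–Titchmarsh coefficients -/

/-- `m` is a coefficient such that `Θ(z, ·) + m Φ(z, ·)` is square integrable on the half-line,
where `Θ(z, ·)`, `Φ(z, ·)` are the `z`-wave functions of `A d/dx + Q` with initial values `Θ₀`,
`Φ₀` at `0`. -/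
def IsWeylCoeff (A : Mat2) (Q : ℝ → Mat2) (Θ₀ Φ₀ : Spinor) (s : Side) (z m : ℂ) : Prop :=
  ∃ Θ Φ : ℝ → Spinor, IsWaveFunction A Q z Θ ∧ IsWaveFunction A Q z Φ ∧ Θ 0 = Θ₀ ∧ Φ 0 = Φ₀ ∧
    MemLp (fun x => Θ x + m • Φ x) 2 (volume.restrict s.halfLine)

/-- `Θ(z, 0)` for the Hamiltonian system. -/
def thetaHam (θ : ℝ) : Spinor := !₂[(Real.cos θ : ℂ), (Real.sin θ : ℂ)]

/-- `Φ(z, 0)` for the Hamiltonian system. -/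
def phiHam (θ : ℝ) : Spinor := !₂[-(Real.sin θ : ℂ), (Real.cos θ : ℂ)]

/-- `Θ(z, 0)` for the Dirac system. -/
def thetaDirac (θ : ℝ) : Spinor :=
  !₂[-((1 + Complex.I) / 2) * Complex.exp (Complex.I * θ),
    -((1 + Complex.I) / 2) * Complex.exp (-(Complex.I * θ))]

/-- `Φ(z, 0)` for the Dirac system. -/
def phiDirac (θ : ℝ) : Spinor :=
  !₂[(1 - Complex.I) / 2 * Complex.exp (Complex.I * θ),
    -((1 - Complex.I) / 2) * Complex.exp (-(Complex.I * θ))]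

theorem act_unitaryU_thetaDirac (θ : ℝ) : act unitaryU (thetaDirac θ) = thetaHam θ := by
  ext j
  fin_cases j <;>
    simp [act_apply, unitaryU, thetaDirac, thetaHam, Complex.ext_iff, Complex.exp_re,
      Complex.exp_im, Complex.cos_ofReal_re, Complex.sin_ofReal_re] <;>
    exact ⟨by ring, by ring⟩

theorem act_unitaryU_phiDirac (θ : ℝ) : act unitaryU (phiDirac θ) = phiHam θ := by
  ext j
  fin_cases j <;>
    simp [act_apply, unitaryU, phiDirac, phiHam, Complex.ext_iff, Complex.exp_re,
      Complex.exp_im, Complex.cos_ofReal_re, Complex.sin_ofReal_re] <;>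
    exact ⟨by ring, by ring⟩

/-- `m` is a half-line Weyl–Titchmarsh coefficient of the Dirac system at `z`, for `β(θ)`. -/
def IsWeylDirac (q : ℝ → ℂ) (s : Side) (z : ℂ) (θ : ℝ) (m : ℂ) : Prop :=
  IsWeylCoeff diracMatrix (diracPotential q) (thetaDirac θ) (phiDirac θ) s z m

/-- `m` is a half-line Weyl–Titchmarsh coefficient of the Hamiltonian system at `z`, for
`α(θ) = (cos θ, sin θ)`. -/
def IsWeylHam (q : ℝ → ℂ) (s : Side) (z : ℂ) (θ : ℝ) (m : ℂ) : Prop :=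
  IsWeylCoeff hamMatrix (hamPotential q) (thetaHam θ) (phiHam θ) s z m

/-- The half-line Weyl–Titchmarsh coefficient of the Dirac system at `z`, for `β(θ)`
(meaningful where it exists and is unique). -/
def weylDirac (q : ℝ → ℂ) (s : Side) (z : ℂ) (θ : ℝ) : ℂ :=
  Classical.epsilon (IsWeylDirac q s z θ)

/-- The half-line Weyl–Titchmarsh coefficient of the Hamiltonian system at `z`, for `α(θ)`
(meaningful where it exists and is unique). -/
def weylHam (q : ℝ → ℂ) (s : Side) (z : ℂ) (θ : ℝ) : ℂ :=
  Classical.epsilon (IsWeylHam q s z θ)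

end

/-! ### Absolutely continuous functions -/

/-! Everything rests on the antiunitary map `J (v₁, v₂) = (conj v₂, -conj v₁)`, `conjSwap`, which
satisfies `J² = -1` and commutes with the Dirac expression. It therefore turns solutions at `z` into
solutions at `conj z`, preserves square integrability, and sends the initial values by `Θ ↦ -Φ`, `Φ
↦ Θ`, which is the change of angle `θ ↦ θ - π/2`.

Applied to a square integrable `Θ + m Φ` at `z`, it gives a square integrable `-Φ + conj m • Θ` at
`conj z`. Read with the angle `θ - π/2`, this says that the coefficient is `conj m`
(`IsWeylDirac.conj_sub_pi_div_two`). Read with the angle `θ`, and divided by `conj m` if `m ≠ 0`, it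
says that the coefficient is `-(conj m)⁻¹` (`IsWeylDirac.conj_of_ne_zero`). Conversely, a
coefficient `m'` at `conj z` returns to `z`; it cannot be `0`, since then `Φ` at `z` would be an
eigenfunction of the half-line operator, so uniqueness at `z` forces `m = -(conj m')⁻¹ ≠ 0`.

At a point of the half-line resolvent set the coefficient is unique because there are no
eigenvalues, and it exists because the resolvent corrects a cut-off solution to a square integrable
one (`exists_memLp_solution`). This needs existence and uniqueness for systems with merely locally
integrable coefficients. Conjugating a resolvent by `J` moves resolvent sets from `z` to `conj z`,
and the unitary matrix `U` carries all results over to the Hamiltonian system. -/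

theorem AbsolutelyContinuousOnInterval.of_dist_le {X Y : Type*} [PseudoMetricSpace X]
    [PseudoMetricSpace Y] {f : ℝ → X} {g : ℝ → Y} {a b C : ℝ}
    (hf : AbsolutelyContinuousOnInterval f a b)
    (h : ∀ x ∈ uIcc a b, ∀ y ∈ uIcc a b, dist (g x) (g y) ≤ C * dist (f x) (f y)) :
    AbsolutelyContinuousOnInterval g a b := by
  have h0 : Filter.Tendsto (fun E : ℕ × (ℕ → ℝ × ℝ) ↦
      C * ∑ i ∈ Finset.range E.1, dist (f (E.2 i).1) (f (E.2 i).2))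
      (AbsolutelyContinuousOnInterval.totalLengthFilter ⊓
        Filter.principal (AbsolutelyContinuousOnInterval.disjWithin a b)) (𝓝 0) := by
    simpa using Filter.Tendsto.const_mul C hf
  refine squeeze_zero' (Filter.Eventually.of_forall fun E =>
    Finset.sum_nonneg fun i _ => dist_nonneg) ?_ h0
  refine Filter.eventually_inf_principal.2 (Filter.Eventually.of_forall fun E hE => ?_)
  rw [Finset.mul_sum]
  exact Finset.sum_le_sum fun i hi => h _ (hE.1 i hi).1 _ (hE.1 i hi).2

theorem AbsolutelyContinuousOnInterval.lipschitz_comp {X Y : Type*} [PseudoMetricSpace X]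
    [PseudoMetricSpace Y] {f : ℝ → X} {g : X → Y} {a b : ℝ} {C : NNReal}
    (hf : AbsolutelyContinuousOnInterval f a b) (hg : LipschitzOnWith C g (f '' uIcc a b)) :
    AbsolutelyContinuousOnInterval (fun x => g (f x)) a b :=
  hf.of_dist_le fun _ hx _ hy => hg.dist_le_mul _ (mem_image_of_mem f hx) _ (mem_image_of_mem f hy)

theorem AbsolutelyContinuousOnInterval.contDiff_comp {f g : ℝ → ℝ} {a b : ℝ}
    (hf : AbsolutelyContinuousOnInterval f a b) (hg : ContDiff ℝ 1 g) :
    AbsolutelyContinuousOnInterval (fun x => g (f x)) a b := by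
  obtain ⟨C, hC⟩ := hf.exists_bound
  obtain ⟨K, hK⟩ := hg.contDiffOn.exists_lipschitzOnWith (s := Icc (-C) C) (by decide)
    (convex_Icc _ _) isCompact_Icc
  refine hf.lipschitz_comp (hK.mono ?_)
  rintro _ ⟨x, hx, rfl⟩
  exact abs_le.1 (hC x hx)

/-- The increments are dominated by those of the real primitive of `‖f‖`. -/
theorem absolutelyContinuousOnInterval_primitive {E : Type*} [NormedAddCommGroup E]
    [NormedSpace ℝ E] {f : ℝ → E} (hf : ∀ a b, IntervalIntegrable f volume a b) (c a b : ℝ) :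
    AbsolutelyContinuousOnInterval (fun x => ∫ t in c..x, f t) a b := by
  refine ((hf a b).norm.absolutelyContinuousOnInterval_intervalIntegral
    left_mem_uIcc).of_dist_le (C := 1) fun x _ y _ => ?_
  rw [dist_eq_norm, dist_eq_norm, intervalIntegral.integral_interval_sub_left (hf _ _) (hf _ _),
    intervalIntegral.integral_interval_sub_left (hf _ _).norm (hf _ _).norm, one_mul,
    Real.norm_eq_abs]
  exact intervalIntegral.norm_integral_le_abs_integral_norm

theorem locallyIntegrable_of_intervalIntegrable {E : Type*} [NormedAddCommGroup E]
    {f : ℝ → E} (hf : ∀ a b, IntervalIntegrable f volume a b) : LocallyIntegrable f volume :=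
  fun x => ⟨Ioc (x - 1) (x + 1), Ioc_mem_nhds (by linarith) (by linarith),
    (intervalIntegrable_iff_integrableOn_Ioc_of_le (by linarith)).1 (hf (x - 1) (x + 1))⟩

theorem MeasureTheory.LocallyIntegrable.intervalIntegrable' {E : Type*} [NormedAddCommGroup E]
    {f : ℝ → E} (hf : LocallyIntegrable f volume) (a b : ℝ) : IntervalIntegrable f volume a b :=
  intervalIntegrable_iff.2 ((hf.integrableOn_isCompact isCompact_uIcc).mono_set uIoc_subset_uIcc)

/-! ### Linear systems with locally integrable coefficients -/

section LinearSystem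

variable {𝕜 E : Type*} [NontriviallyNormedField 𝕜] [NormedAddCommGroup E] [NormedSpace 𝕜 E]
  {N : ℝ → E →L[𝕜] E}

theorem intervalIntegrable_apply_of_continuous
    (hN : ∀ a b, IntervalIntegrable N volume a b) {u : ℝ → E} (hu : Continuous u) (a b : ℝ) :
    IntervalIntegrable (fun t => N t (u t)) volume a b := by
  have h1 : IntervalIntegrable (fun t => ‖u t‖ * ‖N t‖) volume a b :=
    (hN a b).norm.continuousOn_mul hu.norm.continuousOn
  refine h1.mono_fun ?_ (Filter.Eventually.of_forall fun t => ?_)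
  · exact (ContinuousLinearMap.id 𝕜 (E →L[𝕜] E)).aestronglyMeasurable_comp₂
      (intervalIntegrable_iff.1 (hN a b)).aestronglyMeasurable hu.aestronglyMeasurable
  · simpa [mul_comm] using (N t).le_opNorm (u t)

/-- The primitive `K` of `k` is only absolutely continuous, so this is the fundamental theorem for
`sinh (2 K) / 2`, with `K' = k` a.e. The factor `2` becomes the contraction constant `1/2` of the
Picard map. -/
theorem integral_mul_cosh_primitive {k : ℝ → ℝ} (hk : ∀ a b, IntervalIntegrable k volume a b)
    (x : ℝ) :
    ∫ t in (0 : ℝ)..x, k t * Real.cosh (2 * ∫ s in (0 : ℝ)..t, k s) =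
      Real.sinh (2 * ∫ s in (0 : ℝ)..x, k s) / 2 := by
  have hac := (absolutelyContinuousOnInterval_primitive hk 0 0 x).contDiff_comp
    (g := fun y => Real.sinh (2 * y) / 2) (by fun_prop)
  have h := hac.integral_deriv_eq_sub
  simp only [intervalIntegral.integral_same, mul_zero, Real.sinh_zero, zero_div, sub_zero] at h
  rw [← h]
  refine intervalIntegral.integral_congr_ae ?_
  filter_upwards [LocallyIntegrable.ae_hasDerivAt_integral
    (locallyIntegrable_of_intervalIntegrable hk)] with t ht _
  rw [(((ht 0).const_mul 2).sinh.div_const 2).deriv]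
  ring

/-- A linear system with locally integrable coefficients has a global solution for every initial
value. -/
theorem exists_integral_solution [NormedSpace ℝ E] [CompleteSpace E]
    (hN : ∀ a b, IntervalIntegrable N volume a b) (v : E) :
    ∃ Ψ : ℝ → E, Continuous Ψ ∧ ∀ x, Ψ x = v + ∫ t in (0 : ℝ)..x, N t (Ψ t) := by
  set k : ℝ → ℝ := fun t => ‖N t‖ with hk
  have hkI : ∀ a b, IntervalIntegrable k volume a b := fun a b => (hN a b).norm
  set K : ℝ → ℝ := fun x => ∫ t in (0 : ℝ)..x, k t
  have hKc : Continuous K := intervalIntegral.continuous_primitive hkI 0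
  -- The weight of a Bielecki norm: `cosh (2 K)` replaces `exp (2 |K|)`, handles both directions
  -- from `0` at once, and is a smooth function of `K`.
  set w : ℝ → ℝ := fun x => Real.cosh (2 * K x) with hw
  have hwc : Continuous w := by fun_prop
  have hw1 : ∀ x, 1 ≤ w x := fun x => Real.one_le_cosh _
  have hw0 : ∀ x, 0 < w x := fun x => Real.cosh_pos _
  have hkw : ∀ a b, IntervalIntegrable (fun t => k t * w t) volume a b := fun a b =>
    (hkI a b).mul_continuousOn hwc.continuousOn
  have key : ∀ (u : ℝ → E) (C : ℝ), 0 ≤ C → (∀ t, ‖u t‖ ≤ C) → ∀ x,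
      ‖∫ t in (0 : ℝ)..x, N t (w t • u t)‖ ≤ C / 2 * w x := by
    intro u C hC hu x
    have h1 : ‖∫ t in (0 : ℝ)..x, N t (w t • u t)‖ ≤ |∫ t in (0 : ℝ)..x, C * (k t * w t)| := by
      refine intervalIntegral.norm_integral_le_abs_of_norm_le
        (Filter.Eventually.of_forall fun t => ?_) ((hkw 0 x).const_mul C)
      calc ‖N t (w t • u t)‖ ≤ k t * ‖w t • u t‖ := (N t).le_opNorm _
        _ = k t * (w t * ‖u t‖) := by rw [norm_smul, Real.norm_of_nonneg (hw0 t).le]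
        _ ≤ k t * (w t * C) := by
          have := hu t
          have := (hw0 t).le
          have : 0 ≤ k t := norm_nonneg _
          gcongr
        _ = C * (k t * w t) := by ring
    rw [intervalIntegral.integral_const_mul, integral_mul_cosh_primitive hkI] at h1
    refine h1.trans ?_
    rw [abs_mul, abs_of_nonneg hC, abs_div, abs_two, Real.abs_sinh]
    have h2 : Real.sinh |2 * K x| ≤ w x := by
      rw [hw]; dsimp only; rw [← Real.cosh_abs]; exact (Real.sinh_lt_cosh _).le
    calc C * (Real.sinh |2 * K x| / 2) ≤ C * (w x / 2) := by gcongr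
      _ = C / 2 * w x := by ring
  have hNu : ∀ u : BoundedContinuousFunction ℝ E, ∀ a b,
      IntervalIntegrable (fun t => N t (w t • u t)) volume a b := fun u a b =>
    intervalIntegrable_apply_of_continuous hN (hwc.smul u.continuous) a b
  -- The Picard map for `u = Ψ / w`; the weight makes it a contraction of bounded functions on all
  -- of `ℝ`, so no continuation of local solutions is needed.
  let T : BoundedContinuousFunction ℝ E → BoundedContinuousFunction ℝ E := fun u =>
    BoundedContinuousFunction.ofNormedAddCommGroup
      (fun x => (w x)⁻¹ • (v + ∫ t in (0 : ℝ)..x, N t (w t • u t)))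
      ((hwc.inv₀ fun x => (hw0 x).ne').smul
        (continuous_const.add (intervalIntegral.continuous_primitive (hNu u) 0)))
      (‖v‖ + ‖u‖ / 2) (fun x => by
        rw [norm_smul, norm_inv, Real.norm_of_nonneg (hw0 x).le, inv_mul_le_iff₀ (hw0 x)]
        have h1 := key u ‖u‖ (norm_nonneg _) u.norm_coe_le_norm x
        have h2 := norm_add_le v (∫ t in (0 : ℝ)..x, N t (w t • u t))
        nlinarith [norm_nonneg v, hw1 x])
  have hT : ∀ u x, T u x = (w x)⁻¹ • (v + ∫ t in (0 : ℝ)..x, N t (w t • u t)) := fun _ _ => rfl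
  have hcontr : ContractingWith (1 / 2) T := by
    refine ⟨by rw [← NNReal.coe_lt_coe]; norm_num, LipschitzWith.of_dist_le_mul fun u u' => ?_⟩
    rw [BoundedContinuousFunction.dist_le (by positivity)]
    intro x
    rw [hT, hT, dist_eq_norm, ← smul_sub, add_sub_add_left_eq_sub,
      ← intervalIntegral.integral_sub (hNu u 0 x) (hNu u' 0 x), norm_smul, norm_inv,
      Real.norm_of_nonneg (hw0 x).le, inv_mul_le_iff₀ (hw0 x)]
    have h1 := key (u - u') (dist u u') dist_nonneg
      (fun t => by simpa [← dist_eq_norm] using u.dist_coe_le_dist (g := u') t) x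
    have h2 : ∀ t, N t (w t • u t) - N t (w t • u' t) = N t (w t • (u - u' : ℝ → E) t) := by
      intro t; rw [← map_sub, ← smul_sub]; rfl
    simp only [h2]
    refine h1.trans (le_of_eq ?_)
    push_cast; ring
  set u := ContractingWith.fixedPoint T hcontr
  have hu : T u = u := hcontr.fixedPoint_isFixedPt
  refine ⟨fun x => w x • u x, hwc.smul u.continuous, fun x => ?_⟩
  have := hT u x
  rw [hu] at this
  dsimp only
  rw [this, smul_smul, mul_inv_cancel₀ (hw0 x).ne', one_smul]

/-- A linear system with locally integrable coefficients has a global locally absolutely continuous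
solution for every initial value. -/
theorem exists_absolutelyContinuous_solution [NormedSpace ℝ E] [CompleteSpace E]
    (hN : ∀ a b, IntervalIntegrable N volume a b) (v : E) :
    ∃ Ψ : ℝ → E, (∀ a b, AbsolutelyContinuousOnInterval Ψ a b) ∧ Ψ 0 = v ∧
      ∀ᵐ x, HasDerivAt Ψ (N x (Ψ x)) x := by
  obtain ⟨Ψ, hc, h⟩ := exists_integral_solution hN v
  have hI := intervalIntegrable_apply_of_continuous hN hc
  have hΨ : Ψ = fun x => v + ∫ t in (0 : ℝ)..x, N t (Ψ t) := funext h
  refine ⟨Ψ, fun a b => ?_, by rw [h]; simp, ?_⟩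
  · rw [hΨ]
    refine (absolutelyContinuousOnInterval_primitive hI 0 a b).of_dist_le (C := 1) ?_
    intro x _ y _
    simp
  · filter_upwards [LocallyIntegrable.ae_hasDerivAt_integral
      (locallyIntegrable_of_intervalIntegrable hI)] with x hx
    have := (hx 0).const_add v
    rwa [← hΨ] at this

end LinearSystem

/-! ### Transformations intertwining two expressions -/

section Transform

variable {τ : Spinor →L[ℝ] Spinor} {A A' : Mat2} {Q Q' : ℝ → Mat2} {I : Set ℝ}

theorem LocallyAbsContOn.map (τ : Spinor →L[ℝ] Spinor) {Ψ : ℝ → Spinor}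
    (h : LocallyAbsContOn Ψ I) : LocallyAbsContOn (fun x => τ (Ψ x)) I :=
  fun a ha b hb => (h a ha b hb).lipschitz_comp τ.lipschitz.lipschitzOnWith

/-- Differentiation is in a real variable, so real linearity of `τ` suffices; this covers both the
unitary `U` and the antilinear symmetry. -/
theorem ExprEq.map {Ψ g : ℝ → Spinor} (h : ExprEq A Q I Ψ g)
    (hτ : ∀ x v w, act A' (τ v) + act (Q' x) (τ w) = τ (act A v + act (Q x) w)) :
    ExprEq A' Q' I (fun x => τ (Ψ x)) (fun x => τ (g x)) := by
  filter_upwards [h] with x hx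
  have hd := τ.hasFDerivAt.comp_hasDerivAt x hx.1.hasDerivAt
  refine ⟨hd.differentiableAt, ?_⟩
  change act A' (deriv (τ ∘ Ψ) x) + _ = _
  rw [hd.deriv, hτ, hx.2]

theorem ExprEq.congr {Ψ g g' : ℝ → Spinor} (h : ExprEq A Q I Ψ g)
    (hg : g =ᵐ[volume.restrict I] g') : ExprEq A Q I Ψ g' := by
  filter_upwards [h, hg] with x hx hgx using ⟨hx.1, hx.2.trans hgx⟩

theorem ExprEq.sub {Ψ Ψ' g g' : ℝ → Spinor} (h : ExprEq A Q I Ψ g) (h' : ExprEq A Q I Ψ' g') :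
    ExprEq A Q I (fun x => Ψ x - Ψ' x) (fun x => g x - g' x) := by
  filter_upwards [h, h'] with x hx hx'
  refine ⟨hx.1.sub hx'.1, ?_⟩
  rw [deriv_fun_sub hx.1 hx'.1, ← hx.2, ← hx'.2, map_sub, map_sub]
  abel

theorem ExprEq.add_const_smul {Ψ Ψ' g g' : ℝ → Spinor} (h : ExprEq A Q I Ψ g)
    (h' : ExprEq A Q I Ψ' g') (c : ℂ) :
    ExprEq A Q I (fun x => Ψ x + c • Ψ' x) (fun x => g x + c • g' x) := by
  filter_upwards [h, h'] with x hx hx'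
  refine ⟨hx.1.add (hx'.1.const_smul c), ?_⟩
  rw [deriv_fun_add hx.1 (hx'.1.fun_const_smul c), deriv_fun_const_smul c hx'.1, ← hx.2, ← hx'.2,
    map_add, map_add, map_smul, map_smul, smul_add]
  abel

theorem ExprEq.mono {J : Set ℝ} {Ψ g : ℝ → Spinor} (h : ExprEq A Q I Ψ g) (hJ : J ⊆ I) :
    ExprEq A Q J Ψ g :=
  ae_mono (Measure.restrict_mono hJ le_rfl) h

theorem IsWaveFunction.map {z z' : ℂ} {Ψ : ℝ → Spinor} (h : IsWaveFunction A Q z Ψ)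
    (hτ : ∀ x v w, act A' (τ v) + act (Q' x) (τ w) = τ (act A v + act (Q x) w))
    (hz : ∀ v, τ (z • v) = z' • τ v) : IsWaveFunction A' Q' z' (fun x => τ (Ψ x)) :=
  ⟨h.1.map τ, (h.2.map hτ).congr (Filter.Eventually.of_forall fun _ => hz _)⟩

theorem IsWeylCoeff.map {z z' m m' : ℂ} {Θ₀ Φ₀ : Spinor} {s : Side}
    (h : IsWeylCoeff A Q Θ₀ Φ₀ s z m)
    (hτ : ∀ x v w, act A' (τ v) + act (Q' x) (τ w) = τ (act A v + act (Q x) w))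
    (hz : ∀ v, τ (z • v) = z' • τ v) (hm : ∀ v, τ (m • v) = m' • τ v) :
    IsWeylCoeff A' Q' (τ Θ₀) (τ Φ₀) s z' m' := by
  obtain ⟨Θ, Φ, hΘ, hΦ, rfl, rfl, hL⟩ := h
  refine ⟨_, _, hΘ.map hτ hz, hΦ.map hτ hz, rfl, rfl, ?_⟩
  simpa [Function.comp_def, hm] using τ.comp_memLp' hL

/-- Dividing `-Φ + m Θ` by `m` gives `Θ - m⁻¹ Φ`. -/
theorem IsWeylCoeff.swap {z m : ℂ} {Θ₀ Φ₀ : Spinor} {s : Side}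
    (h : IsWeylCoeff A Q (-Φ₀) Θ₀ s z m) (hm : m ≠ 0) : IsWeylCoeff A Q Θ₀ Φ₀ s z (-m⁻¹) := by
  obtain ⟨Θ, Φ, hΘ, hΦ, h0, rfl, hL⟩ := h
  have hneg : ∀ v : Spinor, (-ContinuousLinearMap.id ℝ Spinor) v = -v := fun v => by simp
  refine ⟨Φ, fun x => -Θ x, hΦ, ?_, rfl, by simp [h0], ?_⟩
  · have := hΘ.map (τ := -ContinuousLinearMap.id ℝ Spinor) (A' := A) (Q' := Q) (z' := z)
      (fun x v w => by simp only [hneg, map_neg]; abel) (fun v => by simp)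
    simpa using this
  · refine (memLp_congr_ae (Filter.Eventually.of_forall fun x => ?_)).1 (hL.const_smul m⁻¹)
    simp only [Pi.smul_apply, smul_add, smul_smul, inv_mul_cancel₀ hm, one_smul, neg_smul, smul_neg,
      neg_neg]
    abel

end Transform

/-! ### The unitary equivalence of the Dirac and Hamiltonian systems. -/

noncomputable section

/-- The unitary matrix `U` as a real-linear map. -/
def unitaryMap : Spinor →L[ℝ] Spinor :=
  (act unitaryU).toContinuousLinearMap.restrictScalars ℝ

/-- The inverse of `U` as a real-linear map. -/
def unitaryInv : Spinor →L[ℝ] Spinor :=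
  (act unitaryUᴴ).toContinuousLinearMap.restrictScalars ℝ

theorem unitaryMap_apply (v : Spinor) : unitaryMap v = act unitaryU v := rfl

theorem unitaryInv_apply (v : Spinor) : unitaryInv v = act unitaryUᴴ v := rfl

theorem act_mul (A B : Mat2) (v : Spinor) : act (A * B) v = act A (act B v) := by
  ext j
  simp only [act_apply, Matrix.mul_apply, Fin.sum_univ_two]
  ring

theorem act_one (v : Spinor) : act 1 v = v := by
  ext j
  fin_cases j <;> simp [act_apply]

theorem unitaryInv_unitaryMap (v : Spinor) : unitaryInv (unitaryMap v) = v := by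
  rw [unitaryInv_apply, unitaryMap_apply, ← act_mul,
    mul_eq_one_comm.1 unitaryU_mul_conjTranspose, act_one]

theorem unitaryMap_unitaryInv (v : Spinor) : unitaryMap (unitaryInv v) = v := by
  rw [unitaryInv_apply, unitaryMap_apply, ← act_mul, unitaryU_mul_conjTranspose, act_one]

theorem unitaryMap_intertwines (q : ℝ → ℂ) (x : ℝ) (v w : Spinor) :
    act hamMatrix (unitaryMap v) + act (hamPotential q x) (unitaryMap w) =
      unitaryMap (act diracMatrix v + act (diracPotential q x) w) := by
  simp only [unitaryMap_apply, map_add, ← act_mul, unitaryU_mul_diracMatrix,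
    unitaryU_mul_diracPotential]

theorem unitaryInv_intertwines (q : ℝ → ℂ) (x : ℝ) (v w : Spinor) :
    act diracMatrix (unitaryInv v) + act (diracPotential q x) (unitaryInv w) =
      unitaryInv (act hamMatrix v + act (hamPotential q x) w) := by
  have := unitaryMap_intertwines q x (unitaryInv v) (unitaryInv w)
  rw [unitaryMap_unitaryInv, unitaryMap_unitaryInv] at this
  rw [this, unitaryInv_unitaryMap]

/-- `U` is complex linear and matches the initial values of the two systems, so `m` is unchanged and
only the Dirac system has to be studied. -/
theorem isWeylHam_iff (q : ℝ → ℂ) (s : Side) (z : ℂ) (θ : ℝ) (m : ℂ) :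
    IsWeylHam q s z θ m ↔ IsWeylDirac q s z θ m := by
  constructor
  · intro h
    have := IsWeylCoeff.map (τ := unitaryInv) (z' := z) (m' := m) h (unitaryInv_intertwines q)
      (fun v => by simp only [unitaryInv_apply, map_smul])
      (fun v => by simp only [unitaryInv_apply, map_smul])
    rwa [← act_unitaryU_thetaDirac, ← act_unitaryU_phiDirac, ← unitaryMap_apply,
      ← unitaryMap_apply, unitaryInv_unitaryMap, unitaryInv_unitaryMap] at this
  · intro h
    have := IsWeylCoeff.map (τ := unitaryMap) (z' := z) (m' := m) h (unitaryMap_intertwines q)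
      (fun v => by simp only [unitaryMap_apply, map_smul])
      (fun v => by simp only [unitaryMap_apply, map_smul])
    rwa [unitaryMap_apply, unitaryMap_apply, act_unitaryU_thetaDirac,
      act_unitaryU_phiDirac] at this

/-! ### The antiunitary symmetry `(ψ₁, ψ₂) ↦ (conj ψ₂, -conj ψ₁)` of the Dirac expression -/

/-- The antiunitary map `(v₁, v₂) ↦ (conj v₂, -conj v₁)`. -/
def conjSwap : Spinor →L⋆[ℂ] Spinor :=
  LinearIsometry.toContinuousLinearMap
    { toFun := fun v => !₂[conj (v 1), -conj (v 0)]
      map_add' := fun v w => by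
        ext j; fin_cases j <;> simp
        ring
      map_smul' := fun c v => by ext j; fin_cases j <;> simp
      norm_map' := fun v => by
        simp [EuclideanSpace.norm_eq, Fin.sum_univ_two, add_comm] }

theorem conjSwap_apply (v : Spinor) : conjSwap v = !₂[conj (v 1), -conj (v 0)] := rfl

/-- `conjSwap` as a real-linear map. -/
def conjSwapReal : Spinor →L[ℝ] Spinor where
  toFun := conjSwap
  map_add' := map_add conjSwap
  map_smul' c v := by
    ext j; fin_cases j <;> simp [conjSwap_apply]
  cont := conjSwap.continuous

theorem conjSwapReal_apply (v : Spinor) : conjSwapReal v = conjSwap v := rfl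

theorem conjSwap_conjSwap (v : Spinor) : conjSwap (conjSwap v) = -v := by
  ext j; fin_cases j <;> simp [conjSwap_apply]

theorem conjSwap_intertwines (q : ℝ → ℂ) (x : ℝ) (v w : Spinor) :
    act diracMatrix (conjSwapReal v) + act (diracPotential q x) (conjSwapReal w) =
      conjSwapReal (act diracMatrix v + act (diracPotential q x) w) := by
  simp only [conjSwapReal_apply, conjSwap_apply]
  ext j; fin_cases j <;> simp [act_apply, diracMatrix, diracPotential, add_comm]

theorem thetaDirac_sub_pi_div_two (θ : ℝ) : thetaDirac (θ - Real.pi / 2) = -phiDirac θ := by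
  have h1 : Complex.exp (Complex.I * (Real.pi / 2)) = Complex.I := by
    rw [mul_comm, Complex.exp_pi_div_two_mul_I]
  ext j
  fin_cases j <;>
    simp [thetaDirac, phiDirac, mul_sub, Complex.exp_sub, Complex.exp_neg, h1] <;>
    field_simp <;> ring_nf <;> simp <;> ring

theorem phiDirac_sub_pi_div_two (θ : ℝ) : phiDirac (θ - Real.pi / 2) = thetaDirac θ := by
  have h1 : Complex.exp (Complex.I * (Real.pi / 2)) = Complex.I := by
    rw [mul_comm, Complex.exp_pi_div_two_mul_I]
  ext j
  fin_cases j <;>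
    simp [thetaDirac, phiDirac, mul_sub, Complex.exp_sub, Complex.exp_neg, h1] <;>
    field_simp <;> ring_nf <;> simp <;> ring

/-- Together with the shift formulas for `θ - π/2`, this identifies the symmetry on initial values
with a rotation of the boundary condition. -/
theorem conjSwap_thetaDirac (θ : ℝ) : conjSwap (thetaDirac θ) = -phiDirac θ := by
  ext j
  fin_cases j <;>
    simp [conjSwap_apply, thetaDirac, phiDirac, ← Complex.exp_conj, map_ofNat] <;> ring

theorem conjSwap_phiDirac (θ : ℝ) : conjSwap (phiDirac θ) = thetaDirac θ := by
  have := congrArg conjSwap (conjSwap_thetaDirac θ)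
  rw [conjSwap_conjSwap, map_neg, neg_inj] at this
  exact this.symm

theorem mem_boundarySpace_betaVec_iff (θ : ℝ) (v : Spinor) :
    v ∈ boundarySpace (betaVec θ) ↔ ∃ c : ℂ, v = c • phiDirac θ := by
  have hI : (1 - Complex.I) * (1 + Complex.I) = 2 := by
    linear_combination (-1 : ℂ) * Complex.I_sq
  have he : Complex.exp (Complex.I * θ) * Complex.exp (-(Complex.I * θ)) = 1 := by
    rw [← Complex.exp_add, add_neg_cancel, Complex.exp_zero]
  change (betaVec θ 0 * v 0 + betaVec θ 1 * v 1 = 0) ↔ _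
  simp only [betaVec, phiDirac, Matrix.cons_val_zero, Matrix.cons_val_one]
  generalize Complex.exp (Complex.I * θ) = e at *
  generalize Complex.exp (-(Complex.I * θ)) = f at *
  constructor
  · intro h
    -- The inverse of `(1 - i)/2 * e` is `(1 + i) * f`, so the first components agree; the second is
    -- forced by the boundary condition.
    refine ⟨(1 + Complex.I) * f * v 0, ?_⟩
    ext j
    fin_cases j
    · simp
      linear_combination (-v 0) * he - v 0 * e * f / 2 * hI
    · simp
      linear_combination (-1 - Complex.I) * f * h - v 1 * he - v 1 * e * f / 2 * hI
  · rintro ⟨c, rfl⟩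
    simp
    ring

theorem conjSwap_mem_boundarySpace {θ : ℝ} {v : Spinor}
    (hv : v ∈ boundarySpace (betaVec θ)) :
    conjSwap v ∈ boundarySpace (betaVec (θ - Real.pi / 2)) := by
  rw [mem_boundarySpace_betaVec_iff] at *
  obtain ⟨c, rfl⟩ := hv
  exact ⟨conj c, by rw [map_smulₛₗ, conjSwap_phiDirac, phiDirac_sub_pi_div_two]⟩

theorem conjSwap_mem_boundarySpace' {θ : ℝ} {v : Spinor}
    (hv : v ∈ boundarySpace (betaVec (θ - Real.pi / 2))) :
    conjSwap v ∈ boundarySpace (betaVec θ) := by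
  rw [mem_boundarySpace_betaVec_iff] at *
  obtain ⟨c, rfl⟩ := hv
  exact ⟨-conj c, by rw [map_smulₛₗ, phiDirac_sub_pi_div_two, conjSwap_thetaDirac]; simp⟩

end

noncomputable section

/-! ### Wave functions of the Dirac expression -/

/-- The coefficient matrix of the Dirac equation, solved for the derivative. -/
def diracSystem (q : ℝ → ℂ) (z : ℂ) (x : ℝ) : Spinor →L[ℂ] Spinor :=
  (act !![-Complex.I * z, 0; 0, Complex.I * z]).toContinuousLinearMap +
    q x • (act !![0, 1; 0, 0]).toContinuousLinearMap +
    conj (q x) • (act !![0, 0; -1, 0]).toContinuousLinearMap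

theorem diracSystem_apply_zero (q : ℝ → ℂ) (z : ℂ) (x : ℝ) (v : Spinor) :
    diracSystem q z x v 0 = -Complex.I * z * v 0 + q x * v 1 := by
  simp [diracSystem, act_apply]

theorem diracSystem_apply_one (q : ℝ → ℂ) (z : ℂ) (x : ℝ) (v : Spinor) :
    diracSystem q z x v 1 = -conj (q x) * v 0 + Complex.I * z * v 1 := by
  simp [diracSystem, act_apply]
  ring

theorem intervalIntegrable_diracSystem {q : ℝ → ℂ} (hq : LocallyIntegrable q volume) (z : ℂ)
    (a b : ℝ) : IntervalIntegrable (diracSystem q z) volume a b := by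
  have h := hq.intervalIntegrable' a b
  have h' : IntervalIntegrable (fun x => conj (q x)) volume a b :=
    ⟨Complex.conjCLE.toContinuousLinearMap.integrable_comp h.1,
      Complex.conjCLE.toContinuousLinearMap.integrable_comp h.2⟩
  exact ((intervalIntegrable_const (μ := volume)).add
    ⟨h.1.smul_const _, h.2.smul_const _⟩).add ⟨h'.1.smul_const _, h'.2.smul_const _⟩

theorem dirac_equation_iff (q : ℝ → ℂ) (z : ℂ) (x : ℝ) (v w : Spinor) :
    act diracMatrix v + act (diracPotential q x) w = z • w ↔ v = diracSystem q z x w := by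
  constructor
  · intro h
    have h0 := congrArg (fun u : Spinor => u 0) h
    have h1 := congrArg (fun u : Spinor => u 1) h
    simp [act_apply, diracMatrix, diracPotential] at h0 h1
    ext j
    fin_cases j
    · change v 0 = diracSystem q z x w 0
      rw [diracSystem_apply_zero]
      linear_combination (-Complex.I) * h0 + (v 0 - q x * w 1) * Complex.I_sq
    · change v 1 = diracSystem q z x w 1
      rw [diracSystem_apply_one]
      linear_combination Complex.I * h1 + (v 1 + conj (q x) * w 0) * Complex.I_sq
  · rintro rfl
    ext j
    fin_cases j
    · simp [act_apply, diracMatrix, diracPotential, diracSystem_apply_zero]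
      linear_combination (-z * w 0) * Complex.I_sq
    · simp [act_apply, diracMatrix, diracPotential, diracSystem_apply_one]
      linear_combination (-z * w 1) * Complex.I_sq

theorem exprEq_dirac_iff {q : ℝ → ℂ} {z : ℂ} {I : Set ℝ} {Ψ : ℝ → Spinor} :
    ExprEq diracMatrix (diracPotential q) I Ψ (fun x => z • Ψ x) ↔
      ∀ᵐ x ∂(volume.restrict I), HasDerivAt Ψ (diracSystem q z x (Ψ x)) x := by
  refine Filter.eventually_congr (Filter.Eventually.of_forall fun x => ?_)
  rw [dirac_equation_iff]
  exact ⟨fun h => h.2 ▸ h.1.hasDerivAt, fun h => ⟨h.differentiableAt, h.deriv⟩⟩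

theorem exists_isWaveFunction_dirac {q : ℝ → ℂ} (hq : LocallyIntegrable q volume) (z : ℂ)
    (v : Spinor) :
    ∃ Ψ : ℝ → Spinor, IsWaveFunction diracMatrix (diracPotential q) z Ψ ∧ Ψ 0 = v := by
  obtain ⟨Ψ, hac, h0, hd⟩ :=
    exists_absolutelyContinuous_solution (intervalIntegrable_diracSystem hq z) v
  refine ⟨Ψ, ⟨fun a _ b _ => hac a b, exprEq_dirac_iff.2 ?_⟩, h0⟩
  rwa [Measure.restrict_univ]

/-! ### Uniqueness, by constancy of the Wronskian -/

/-- The Wronskian of two vectors of `ℂ²`. -/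
def spinorDet (v w : Spinor) : ℂ := v 0 * w 1 - v 1 * w 0

theorem HasDerivAt.spinor_apply {Ψ : ℝ → Spinor} {v : Spinor} {x : ℝ} (h : HasDerivAt Ψ v x)
    (j : Fin 2) : HasDerivAt (fun t => Ψ t j) (v j) x :=
  ((EuclideanSpace.proj j : Spinor →L[ℂ] ℂ).restrictScalars ℝ).hasFDerivAt.comp_hasDerivAt x h

theorem AbsolutelyContinuousOnInterval.spinor_apply {Ψ : ℝ → Spinor} {a b : ℝ}
    (h : AbsolutelyContinuousOnInterval Ψ a b) (j : Fin 2) :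
    AbsolutelyContinuousOnInterval (fun t => Ψ t j) a b :=
  h.lipschitz_comp (EuclideanSpace.proj j : Spinor →L[ℂ] ℂ).lipschitz.lipschitzOnWith

/-- The coefficient matrix of the system has trace `-iz + iz = 0`, so the Wronskian has derivative
`0` a.e.; absolute continuity makes it constant. -/
theorem spinorDet_solution_eq {q : ℝ → ℂ} {z : ℂ} {I : Set ℝ} (hI : I.OrdConnected)
    (h0 : 0 ∈ I) {Ψ Φ : ℝ → Spinor} (hΨ : LocallyAbsContOn Ψ I) (hΦ : LocallyAbsContOn Φ I)
    (eΨ : ExprEq diracMatrix (diracPotential q) I Ψ (fun x => z • Ψ x))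
    (eΦ : ExprEq diracMatrix (diracPotential q) I Φ (fun x => z • Φ x)) {x : ℝ} (hx : x ∈ I) :
    spinorDet (Ψ x) (Φ x) = spinorDet (Ψ 0) (Φ 0) := by
  have aΨ := hΨ 0 h0 x hx
  have aΦ := hΦ 0 h0 x hx
  rw [exprEq_dirac_iff] at eΨ eΦ
  have hsub : uIcc 0 x ⊆ I := hI.uIcc_subset h0 hx
  have hac : AbsolutelyContinuousOnInterval (fun t => spinorDet (Ψ t) (Φ t)) 0 x :=
    ((aΨ.spinor_apply 0).fun_smul (aΦ.spinor_apply 1)).fun_sub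
      ((aΨ.spinor_apply 1).fun_smul (aΦ.spinor_apply 0))
  obtain ⟨C, hC⟩ := hac.const_of_ae_hasDerivAt_zero (by
    filter_upwards [(ae_restrict_iff' hI.measurableSet).1 eΨ,
      (ae_restrict_iff' hI.measurableSet).1 eΦ] with t h1 h2 ht
    have d1 := h1 (hsub ht)
    have d2 := h2 (hsub ht)
    have := ((d1.spinor_apply 0).mul (d2.spinor_apply 1)).sub
      ((d1.spinor_apply 1).mul (d2.spinor_apply 0))
    refine this.congr_deriv ?_
    simp only [diracSystem_apply_zero, diracSystem_apply_one]
    ring)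
  rw [hC x right_mem_uIcc, hC 0 left_mem_uIcc]

/-- The Wronskians of `Ψ` with a fundamental system `F`, `G` vanish, while that of `F` and `G` is
`1`; Cramer's rule gives `Ψ = 0`. -/
theorem dirac_solution_eq_zero {q : ℝ → ℂ} (hq : LocallyIntegrable q volume) {z : ℂ} {I : Set ℝ}
    (hI : I.OrdConnected) (h0 : 0 ∈ I) {Ψ : ℝ → Spinor} (hΨ : LocallyAbsContOn Ψ I)
    (eΨ : ExprEq diracMatrix (diracPotential q) I Ψ (fun x => z • Ψ x)) (hΨ0 : Ψ 0 = 0) {x : ℝ}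
    (hx : x ∈ I) : Ψ x = 0 := by
  obtain ⟨F, ⟨aF, eF⟩, hF⟩ := exists_isWaveFunction_dirac hq z !₂[1, 0]
  obtain ⟨G, ⟨aG, eG⟩, hG⟩ := exists_isWaveFunction_dirac hq z !₂[0, 1]
  have aF' : LocallyAbsContOn F I := fun a _ b _ => aF a trivial b trivial
  have aG' : LocallyAbsContOn G I := fun a _ b _ => aG a trivial b trivial
  have h1 := spinorDet_solution_eq hI h0 hΨ aF' eΨ (eF.mono (subset_univ I)) hx
  have h2 := spinorDet_solution_eq hI h0 hΨ aG' eΨ (eG.mono (subset_univ I)) hx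
  have h3 := spinorDet_solution_eq hI h0 aF' aG' (eF.mono (subset_univ I))
    (eG.mono (subset_univ I)) hx
  rw [hΨ0, hF] at h1
  rw [hΨ0, hG] at h2
  rw [hF, hG] at h3
  simp [spinorDet] at h1 h2 h3
  ext j
  fin_cases j
  · simp
    linear_combination (-Ψ x 0) * h3 - G x 0 * h1 + F x 0 * h2
  · simp
    linear_combination (-Ψ x 1) * h3 - G x 1 * h1 + F x 1 * h2

/-! ### Resolvent sets -/

/-- The graphs of the realizations are explicit, so the resolvent is best characterized by pairs in
the graph. -/
theorem opResolventSet_eq {E : Type*} [NormedAddCommGroup E] [NormedSpace ℂ E]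
    (T : E →ₗ.[ℂ] E) : opResolventSet T = {z | ∃ R : E →L[ℂ] E,
      (∀ h, (R h, h + z • R h) ∈ T.graph) ∧ ∀ f g, (f, g) ∈ T.graph → R (g - z • f) = f} := by
  ext z
  refine exists_congr fun R => and_congr (forall_congr' fun h => ?_) ?_
  · rw [LinearPMap.mem_graph_iff]
    refine exists_congr fun f => and_congr_right fun hf => ?_
    rw [hf]
    exact sub_eq_iff_eq_add
  · constructor
    · rintro H f g hfg
      obtain ⟨y, hy, hy'⟩ := (LinearPMap.mem_graph_iff T).1 hfg
      dsimp only at hy hy'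
      rw [← hy, ← hy']
      exact H y
    · intro H f
      exact H _ _ (T.mem_graph f)

theorem conj_mem_opResolventSet {E : Type*} [NormedAddCommGroup E] [NormedSpace ℂ E]
    {T T' : E →ₗ.[ℂ] E} (K : E →L⋆[ℂ] E) (hK : ∀ f, K (K f) = -f)
    (h : ∀ f g, (f, g) ∈ T.graph → (K f, K g) ∈ T'.graph)
    (h' : ∀ f g, (f, g) ∈ T'.graph → (K f, K g) ∈ T.graph) {z : ℂ} (hz : z ∈ opResolventSet T) :
    conj z ∈ opResolventSet T' := by
  rw [opResolventSet_eq] at hz ⊢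
  obtain ⟨R, h1, h2⟩ := hz
  -- Since `K⁻¹ = -K`, this is the conjugate of `R` by `K`, linear because `K` occurs twice.
  refine ⟨-(K.comp (R.comp K)), fun f => ?_, fun f g hfg => ?_⟩
  · have := T'.graph.neg_mem (h _ _ (h1 (K f)))
    simpa [hK, map_smulₛₗ, add_comm] using this
  · have := h2 _ _ (h' f g hfg)
    have h3 : K (g - conj z • f) = K g - z • K f := by simp [map_smulₛₗ]
    simp [h3, this, hK]

theorem conjSwap_mem_exprGraph {q : ℝ → ℂ} {I : Set ℝ} {bc bc' : Submodule ℂ Spinor}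
    (hbc : ∀ v ∈ bc, conjSwap v ∈ bc') (f g : L2 I)
    (h : (f, g) ∈ exprGraph diracMatrix (diracPotential q) I bc) :
    (conjSwap.compLpL 2 (volume.restrict I) f, conjSwap.compLpL 2 (volume.restrict I) g) ∈
      exprGraph diracMatrix (diracPotential q) I bc' := by
  obtain ⟨Ψ, h1, h2, h3, h4⟩ := h
  refine ⟨fun x => conjSwapReal (Ψ x), h1.map _, hbc _ h2, ?_,
    (h4.map (conjSwap_intertwines q)).congr (conjSwap.coeFn_compLpL g).symm⟩
  filter_upwards [conjSwap.coeFn_compLpL f, h3] with x hx hx'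
  rw [hx, hx', conjSwapReal_apply]

theorem compLpL_conjSwap_conjSwap {I : Set ℝ} (f : L2 I) :
    conjSwap.compLpL 2 (volume.restrict I) (conjSwap.compLpL 2 (volume.restrict I) f) = -f := by
  refine Lp.ext ?_
  filter_upwards [conjSwap.coeFn_compLpL f, Lp.coeFn_neg f,
    conjSwap.coeFn_compLpL (conjSwap.compLpL 2 (volume.restrict I) f)] with x h1 h2 h3
  rw [h3, h1, h2, conjSwap_conjSwap, Pi.neg_apply]

theorem conj_mem_opResolventSet_diracOp {q : ℝ → ℂ} {z : ℂ}
    (hz : z ∈ opResolventSet (diracOp q)) : conj z ∈ opResolventSet (diracOp q) := by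
  refine conj_mem_opResolventSet (conjSwap.compLpL 2 _) compLpL_conjSwap_conjSwap ?_ ?_ hz <;>
  · rw [diracOp_graph]
    exact conjSwap_mem_exprGraph fun _ _ => trivial

theorem conj_mem_opResolventSet_halfLineDiracOp {q : ℝ → ℂ} {s : Side} {θ : ℝ} {z : ℂ}
    (hz : z ∈ opResolventSet (halfLineDiracOp q s θ)) :
    conj z ∈ opResolventSet (halfLineDiracOp q s (θ - Real.pi / 2)) := by
  refine conj_mem_opResolventSet (conjSwap.compLpL 2 _) compLpL_conjSwap_conjSwap ?_ ?_ hz <;>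
  rw [halfLineDiracOp_graph, halfLineDiracOp_graph]
  · exact conjSwap_mem_exprGraph fun _ => conjSwap_mem_boundarySpace
  · exact conjSwap_mem_exprGraph fun _ => conjSwap_mem_boundarySpace'

end

/-! ### Half-line Weyl–Titchmarsh coefficients -/

theorem Side.zero_mem_halfLine (s : Side) : (0 : ℝ) ∈ s.halfLine := by
  cases s <;> simp [Side.halfLine]

theorem Side.ordConnected_halfLine (s : Side) : s.halfLine.OrdConnected := by
  cases s
  · exact ordConnected_Ici
  · exact ordConnected_Iic

theorem Side.exists_ne_zero_mem_halfLine (s : Side) : ∃ a ∈ s.halfLine, a ≠ 0 := by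
  cases s
  · exact ⟨1, by simp [Side.halfLine], by norm_num⟩
  · exact ⟨-1, by simp [Side.halfLine], by norm_num⟩

theorem eq_zero_of_ae_eq_zero_halfLine {s : Side} {Ψ : ℝ → Spinor}
    (hac : LocallyAbsContOn Ψ s.halfLine) (h : Ψ =ᵐ[volume.restrict s.halfLine] fun _ => 0) :
    Ψ 0 = 0 := by
  obtain ⟨a, ha, ha0⟩ := s.exists_ne_zero_mem_halfLine
  have hsub : uIcc 0 a ⊆ s.halfLine := s.ordConnected_halfLine.uIcc_subset s.zero_mem_halfLine ha
  refine Measure.eqOn_of_ae_eq (μ := volume) (ae_restrict_of_ae_restrict_of_subset hsub h)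
    (hac 0 s.zero_mem_halfLine a ha).continuousOn continuousOn_const ?_ left_mem_uIcc
  rw [uIcc, interior_Icc, closure_Ioo]
  exact (inf_lt_sup.2 (Ne.symm ha0)).ne

section

variable {q : ℝ → ℂ} {s : Side} {θ : ℝ} {z : ℂ}

/-- A point of the resolvent set is not an eigenvalue. -/
theorem apply_zero_eq_zero_of_memLp (hz : z ∈ opResolventSet (halfLineDiracOp q s θ))
    {Ψ : ℝ → Spinor} (hac : LocallyAbsContOn Ψ s.halfLine)
    (he : ExprEq diracMatrix (diracPotential q) s.halfLine Ψ (fun x => z • Ψ x))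
    (hL : MemLp Ψ 2 (volume.restrict s.halfLine)) (hbc : Ψ 0 ∈ boundarySpace (betaVec θ)) :
    Ψ 0 = 0 := by
  rw [opResolventSet_eq] at hz
  obtain ⟨R, -, hR⟩ := hz
  rw [halfLineDiracOp_graph] at hR
  have h0 := hR hL.toLp (z • hL.toLp) ⟨Ψ, hac, hbc, hL.coeFn_toLp, he.congr ?_⟩
  · rw [sub_self, map_zero] at h0
    refine eq_zero_of_ae_eq_zero_halfLine hac ?_
    have h1 := hL.coeFn_toLp
    rw [← h0] at h1
    exact h1.symm.trans (Lp.coeFn_zero _ _ _)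
  · filter_upwards [Lp.coeFn_smul z hL.toLp, hL.coeFn_toLp] with x h1 h2
    rw [h1, Pi.smul_apply, h2]

theorem IsWaveFunction.add_smul {A : Mat2} {Q : ℝ → Mat2} {Θ Φ : ℝ → Spinor}
    (hΘ : IsWaveFunction A Q z Θ) (hΦ : IsWaveFunction A Q z Φ) (m : ℂ) :
    IsWaveFunction A Q z (fun x => Θ x + m • Φ x) := by
  refine ⟨fun a ha b hb => (hΘ.1 a ha b hb).fun_add ((hΦ.1 a ha b hb).const_smul m),
    (hΘ.2.add_const_smul hΦ.2 m).congr (Filter.Eventually.of_forall fun x => ?_)⟩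
  simp only [smul_add, smul_comm m z]

theorem IsWaveFunction.locallyAbsContOn {A : Mat2} {Q : ℝ → Mat2} {Θ : ℝ → Spinor}
    (hΘ : IsWaveFunction A Q z Θ) (I : Set ℝ) : LocallyAbsContOn Θ I :=
  fun a _ b _ => hΘ.1 a trivial b trivial

theorem phiDirac_ne_zero (θ : ℝ) : phiDirac θ ≠ 0 := by
  intro h
  have h0 := congrArg (fun v : Spinor => v 0) h
  have h1 : (1 : ℂ) - Complex.I ≠ 0 := fun h => by simpa using congrArg Complex.re h
  simp [phiDirac, h1] at h0

/-- The difference of two such square integrable solutions starts at `(m - m') Φ₀`, which satisfies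
the boundary condition; an eigenfunction is excluded. -/
theorem IsWeylDirac.unique (hz : z ∈ opResolventSet (halfLineDiracOp q s θ)) {m m' : ℂ}
    (h : IsWeylDirac q s z θ m) (h' : IsWeylDirac q s z θ m') : m = m' := by
  obtain ⟨Θ, Φ, hΘ, hΦ, hΘ0, hΦ0, hL⟩ := h
  obtain ⟨Θ', Φ', hΘ', hΦ', hΘ0', hΦ0', hL'⟩ := h'
  have hw := (hΘ.add_smul hΦ m).add_smul (hΘ'.add_smul hΦ' m') (-1)
  have h0 : (Θ 0 + m • Φ 0) + (-1 : ℂ) • (Θ' 0 + m' • Φ' 0) = (m - m') • phiDirac θ := by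
    rw [hΘ0, hΦ0, hΘ0', hΦ0', sub_smul]
    simp only [neg_smul, one_smul]
    abel
  have := apply_zero_eq_zero_of_memLp hz (hw.locallyAbsContOn _) (hw.2.mono (subset_univ _))
    (hL.add (hL'.const_smul (-1 : ℂ)))
    ((mem_boundarySpace_betaVec_iff θ _).2 ⟨m - m', h0⟩)
  rw [h0, smul_eq_zero] at this
  refine sub_eq_zero.1 (this.resolve_right fun h => ?_)
  exact phiDirac_ne_zero θ h

/-- The coefficient `0` would make the solution starting at `-Φ₀` square integrable, hence an
eigenfunction. -/
theorem not_isWeylCoeff_zero_neg_phiDirac (hz : z ∈ opResolventSet (halfLineDiracOp q s θ)) :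
    ¬ IsWeylCoeff diracMatrix (diracPotential q) (-phiDirac θ) (thetaDirac θ) s z 0 := by
  rintro ⟨Θ, Φ, hΘ, hΦ, hΘ0, hΦ0, hL⟩
  simp only [zero_smul, add_zero] at hL
  have := apply_zero_eq_zero_of_memLp hz (hΘ.locallyAbsContOn _) (hΘ.2.mono (subset_univ _)) hL
    ((mem_boundarySpace_betaVec_iff θ _).2 ⟨-1, by rw [hΘ0]; simp⟩)
  rw [hΘ0, neg_eq_zero] at this
  exact phiDirac_ne_zero θ this

/-! ### Existence of coefficients by means of the resolvent. -/

/-- A complex-valued cutoff function. -/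
theorem exists_cutoff : ∃ η η' : ℝ → ℂ, Continuous η' ∧ HasCompactSupport η ∧
    HasCompactSupport η' ∧ η 0 = 1 ∧ (∀ x, HasDerivAt η (η' x) x) ∧
    ∀ a b, AbsolutelyContinuousOnInterval η a b := by
  obtain ⟨χ⟩ : Nonempty (ContDiffBump (0 : ℝ)) := ⟨⟨1, 2, one_pos, one_lt_two⟩⟩
  have hχd : ContDiff ℝ 1 (χ : ℝ → ℝ) := χ.contDiff
  have hχc : HasCompactSupport (χ : ℝ → ℝ) := χ.hasCompactSupport
  refine ⟨fun x => (χ x : ℂ), fun x => ((deriv (χ : ℝ → ℝ) x : ℝ) : ℂ),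
    Complex.continuous_ofReal.comp (hχd.continuous_deriv le_rfl),
    hχc.comp_left Complex.ofReal_zero, hχc.deriv.comp_left Complex.ofReal_zero, ?_,
    fun x => (hχd.differentiable one_ne_zero x).hasDerivAt.ofReal_comp,
    fun a b => (hχd.contDiffOn.absolutelyContinuousOnInterval).lipschitz_comp
      Complex.isometry_ofReal.lipschitz.lipschitzOnWith⟩
  have : χ 0 = 1 := χ.one_of_mem_closedBall (Metric.mem_closedBall_self χ.rIn_pos.le)
  simp [this]

theorem IsWaveFunction.continuous {A : Mat2} {Q : ℝ → Mat2} {F : ℝ → Spinor}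
    (hF : IsWaveFunction A Q z F) : Continuous F :=
  continuous_iff_continuousAt.2 fun x =>
    (hF.1 (x - 1) trivial (x + 1) trivial).continuousOn.continuousAt
      (by rw [uIcc_of_le (by linarith)]; exact Icc_mem_nhds (by linarith) (by linarith))

/-- Cutting off a wave function. -/
theorem IsWaveFunction.exprEq_smul {A : Mat2} {Q : ℝ → Mat2} {F : ℝ → Spinor}
    (hF : IsWaveFunction A Q z F) {η η' : ℝ → ℂ} (hη : ∀ x, HasDerivAt η (η' x) x) (I : Set ℝ) :
    ExprEq A Q I (fun x => η x • F x) (fun x => act A (η' x • F x) + z • η x • F x) := by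
  filter_upwards [hF.2.mono (subset_univ I)] with x hx
  have h2 : HasDerivAt (fun t => η t • F t) (η x • deriv F x + η' x • F x) x :=
    (hη x).fun_smul hx.1.hasDerivAt
  refine ⟨h2.differentiableAt, ?_⟩
  rw [h2.deriv, map_add, map_smul _ _ (deriv F x), map_smul (act (Q x)), smul_comm z, ← hx.2,
    smul_add]
  abel

/-- There are solutions square integrable on the half-line whose initial value is prescribed modulo
the boundary condition. -/
theorem exists_memLp_solution (hq : LocallyIntegrable q volume)
    (hz : z ∈ opResolventSet (halfLineDiracOp q s θ)) (v : Spinor) :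
    ∃ Ψ : ℝ → Spinor, LocallyAbsContOn Ψ s.halfLine ∧
      ExprEq diracMatrix (diracPotential q) s.halfLine Ψ (fun x => z • Ψ x) ∧
      MemLp Ψ 2 (volume.restrict s.halfLine) ∧ v - Ψ 0 ∈ boundarySpace (betaVec θ) := by
  obtain ⟨F, hF, hF0⟩ := exists_isWaveFunction_dirac hq z v
  obtain ⟨η, η', hη'c, hηs, hη's, hη0, hηd, hηac⟩ := exists_cutoff
  have hFc := hF.continuous
  have hηc : Continuous η := continuous_iff_continuousAt.2 fun x => (hηd x).continuousAt
  have hgL : MemLp (fun x => η x • F x) 2 (volume.restrict s.halfLine) :=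
    (hηc.smul hFc).memLp_of_hasCompactSupport hηs.smul_right
  have hhL : MemLp (fun x => act diracMatrix (η' x • F x)) 2 (volume.restrict s.halfLine) :=
    (act diracMatrix).toContinuousLinearMap.comp_memLp'
      ((hη'c.smul hFc).memLp_of_hasCompactSupport hη's.smul_right)
  have hgac : LocallyAbsContOn (fun x => η x • F x) s.halfLine := fun a _ b _ =>
    (hηac a b).fun_smul (hF.1 a trivial b trivial)
  have hge := hF.exprEq_smul hηd s.halfLine
  rw [opResolventSet_eq] at hz
  obtain ⟨R, hR, -⟩ := hz
  rw [halfLineDiracOp_graph] at hR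
  -- The right side `iσ₃ η' F` is the expression minus `z` applied to `η F`. So `η F - f` solves the
  -- homogeneous equation, and at `0` it differs from `v` only by `f 0`, which satisfies the
  -- boundary condition.
  obtain ⟨f, hfac, hfbc, hfR, hfe⟩ := hR hhL.toLp
  refine ⟨fun x => η x • F x - f x, fun a ha b hb =>
    (hgac a ha b hb).fun_sub (hfac a ha b hb), ?_, ?_, ?_⟩
  · refine (hge.sub hfe).congr ?_
    filter_upwards [Lp.coeFn_add hhL.toLp (z • R hhL.toLp), Lp.coeFn_smul z (R hhL.toLp),
      hhL.coeFn_toLp, hfR] with x h1 h2 h3 h4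
    rw [h1, Pi.add_apply, h2, Pi.smul_apply, h3, h4, smul_sub]
    abel
  · exact hgL.sub ((memLp_congr_ae hfR).1 (Lp.memLp _))
  · simpa [hη0, hF0] using hfbc

theorem exists_isWeylDirac (hq : LocallyIntegrable q volume)
    (hz : z ∈ opResolventSet (halfLineDiracOp q s θ)) : ∃ m, IsWeylDirac q s z θ m := by
  obtain ⟨Ψ, hac, he, hL, hbc⟩ := exists_memLp_solution hq hz (thetaDirac θ)
  obtain ⟨c, hc⟩ := (mem_boundarySpace_betaVec_iff θ _).1 hbc
  obtain ⟨Θ, hΘ, hΘ0⟩ := exists_isWaveFunction_dirac hq z (thetaDirac θ)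
  obtain ⟨Φ, hΦ, hΦ0⟩ := exists_isWaveFunction_dirac hq z (phiDirac θ)
  -- `Θ₀ - Ψ 0 = c Φ₀`, so `Ψ` and `Θ - c Φ` agree at `0`, hence on the half-line.
  refine ⟨-c, Θ, Φ, hΘ, hΦ, hΘ0, hΦ0, (memLp_congr_ae ?_).1 hL⟩
  have hw := hΘ.add_smul hΦ (-c)
  filter_upwards [ae_restrict_mem s.ordConnected_halfLine.measurableSet] with x hx
  refine sub_eq_zero.1 (dirac_solution_eq_zero (z := z)
    (Ψ := fun x => Ψ x - (Θ x + -c • Φ x)) hq s.ordConnected_halfLine s.zero_mem_halfLine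
    (fun a ha b hb => (hac a ha b hb).fun_sub (hw.locallyAbsContOn s.halfLine a ha b hb))
    ((he.sub (hw.2.mono (subset_univ _))).congr
      (Filter.Eventually.of_forall fun x => (smul_sub _ _ _).symm)) ?_ hx)
  rw [hΘ0, hΦ0, neg_smul, ← hc]
  abel

/-! ### The action of the symmetry on coefficients. -/

/-- The antiunitary symmetry, for the angle `θ - π / 2`. -/
theorem IsWeylDirac.conj_sub_pi_div_two {m : ℂ} (h : IsWeylDirac q s z θ m) :
    IsWeylDirac q s (conj z) (θ - Real.pi / 2) (conj m) := by
  have := IsWeylCoeff.map (τ := conjSwapReal) (z' := conj z) (m' := conj m) h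
    (conjSwap_intertwines q) (fun v => map_smulₛₗ conjSwap z v) (fun v => map_smulₛₗ conjSwap m v)
  rw [conjSwapReal_apply, conjSwapReal_apply, conjSwap_thetaDirac, conjSwap_phiDirac] at this
  rwa [IsWeylDirac, thetaDirac_sub_pi_div_two, phiDirac_sub_pi_div_two]

theorem IsWeylDirac.isWeylCoeff_conj {m : ℂ} (h : IsWeylDirac q s z θ m) :
    IsWeylCoeff diracMatrix (diracPotential q) (-phiDirac θ) (thetaDirac θ) s (conj z)
      (conj m) := by
  have := h.conj_sub_pi_div_two
  rwa [IsWeylDirac, thetaDirac_sub_pi_div_two, phiDirac_sub_pi_div_two] at this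

/-- The antiunitary symmetry, for the same angle. -/
theorem IsWeylDirac.conj_of_ne_zero {m : ℂ} (h : IsWeylDirac q s z θ m) (hm : m ≠ 0) :
    IsWeylDirac q s (conj z) θ (-(conj m)⁻¹) :=
  h.isWeylCoeff_conj.swap ((map_ne_zero _).2 hm)

theorem ne_zero_of_isWeylDirac_conj (hz : z ∈ opResolventSet (halfLineDiracOp q s θ)) {m : ℂ}
    (h : IsWeylDirac q s (conj z) θ m) : m ≠ 0 := by
  rintro rfl
  have := h.isWeylCoeff_conj
  rw [Complex.conj_conj, map_zero] at this
  exact not_isWeylCoeff_zero_neg_phiDirac hz this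

/-- The symmetry is used from `conj z` back to `z`, so that only uniqueness at `z` is needed: `conj
z` may fail to be a resolvent point for the angle `θ`. -/
theorem eq_neg_inv_of_isWeylDirac_conj (hz : z ∈ opResolventSet (halfLineDiracOp q s θ))
    {m m' : ℂ} (h : IsWeylDirac q s z θ m) (h' : IsWeylDirac q s (conj z) θ m') :
    m = -(conj m')⁻¹ := by
  have := h'.conj_of_ne_zero (ne_zero_of_isWeylDirac_conj hz h')
  rw [Complex.conj_conj] at this
  exact h.unique hz this

theorem weylHam_eq_weylDirac (q : ℝ → ℂ) (s : Side) (z : ℂ) (θ : ℝ) :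
    weylHam q s z θ = weylDirac q s z θ := by
  rw [weylHam, weylDirac, funext fun m => propext (isWeylHam_iff q s z θ m)]

end

theorem lemma4p4 (q : ℝ → ℂ) (hq : LocallyIntegrable q volume) (θ : ℝ) (s : Side) (z : ℂ)
    (hz : z ∈ opResolventSet (diracOp q) ∩ opResolventSet (halfLineDiracOp q s θ)) :
    -- the coefficients at `z` are well defined, and those of the two systems coincide
    ((∃! m : ℂ, IsWeylDirac q s z θ m) ∧ (∃! m : ℂ, IsWeylHam q s z θ m) ∧
      weylDirac q s z θ = weylHam q s z θ) ∧
    -- the point `conj z` is admissible for the angle `θ - π / 2`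
    (conj z ∈ opResolventSet (diracOp q) ∩
      opResolventSet (halfLineDiracOp q s (θ - Real.pi / 2))) ∧
    -- for the angle `θ`, the coefficient at `conj z` exists exactly if the one at `z` is not `0`,
    -- which is so if `conj z` is admissible for `θ`
    ((conj z ∈ opResolventSet (halfLineDiracOp q s θ) → weylDirac q s z θ ≠ 0) ∧
      ((∃ m : ℂ, IsWeylDirac q s (conj z) θ m) ↔ weylDirac q s z θ ≠ 0) ∧
      ((∃ m : ℂ, IsWeylHam q s (conj z) θ m) ↔ weylHam q s z θ ≠ 0)) ∧
    -- the first identity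
    (weylDirac q s z θ ≠ 0 →
      (∃! m : ℂ, IsWeylDirac q s (conj z) θ m) ∧ (∃! m : ℂ, IsWeylHam q s (conj z) θ m) ∧
      conj (weylDirac q s z θ) = -(weylDirac q s (conj z) θ)⁻¹ ∧
      conj (weylHam q s z θ) = -(weylHam q s (conj z) θ)⁻¹) ∧
    -- the second and the third identity
    conj (weylDirac q s z θ) = weylDirac q s (conj z) (θ - Real.pi / 2) ∧
    conj (weylHam q s z θ) = weylHam q s (conj z) (θ - Real.pi / 2) := by
  obtain ⟨hz, hzh⟩ := hz
  have hzh' := conj_mem_opResolventSet_halfLineDiracOp hzh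
  have hM : IsWeylDirac q s z θ (weylDirac q s z θ) :=
    Classical.epsilon_spec (exists_isWeylDirac hq hzh)
  have hex : (∃ m : ℂ, IsWeylDirac q s (conj z) θ m) ↔ weylDirac q s z θ ≠ 0 := by
    refine ⟨fun ⟨m, hm⟩ => ?_, fun h => ⟨_, hM.conj_of_ne_zero h⟩⟩
    rw [eq_neg_inv_of_isWeylDirac_conj hzh hM hm]
    simpa using ne_zero_of_isWeylDirac_conj hzh hm
  have hU : ∃! m : ℂ, IsWeylDirac q s z θ m := ⟨_, hM, fun _ h => IsWeylDirac.unique hzh h hM⟩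
  have hid : conj (weylDirac q s z θ) = weylDirac q s (conj z) (θ - Real.pi / 2) :=
    IsWeylDirac.unique hzh' hM.conj_sub_pi_div_two
      (Classical.epsilon_spec ⟨_, hM.conj_sub_pi_div_two⟩)
  simp only [isWeylHam_iff, weylHam_eq_weylDirac]
  refine ⟨⟨hU, hU, trivial⟩, ⟨conj_mem_opResolventSet_diracOp hz, hzh'⟩,
    ⟨fun h => hex.1 (exists_isWeylDirac hq h), hex, hex⟩, fun h => ?_, hid, hid⟩
  have hN : IsWeylDirac q s (conj z) θ (weylDirac q s (conj z) θ) :=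
    Classical.epsilon_spec (hex.2 h)
  -- Uniqueness at `conj z` comes from injectivity of `m' ↦ -(conj m')⁻¹`, whose value is the
  -- coefficient at `z`.
  have hNU : ∃! m : ℂ, IsWeylDirac q s (conj z) θ m := by
    refine ⟨_, hN, fun m hm => ?_⟩
    have := (eq_neg_inv_of_isWeylDirac_conj hzh hM hm).symm.trans
      (eq_neg_inv_of_isWeylDirac_conj hzh hM hN)
    simpa only [neg_inj, inv_inj, RingHom.injective _ |>.eq_iff] using this
  have hconj : conj (weylDirac q s z θ) = -(weylDirac q s (conj z) θ)⁻¹ := by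
    have := congrArg conj (eq_neg_inv_of_isWeylDirac_conj hzh hM hN)
    simpa using this
  exact ⟨hNU, hNU, hconj, hconj⟩
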